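/- Let $d\ge 1$, let $\Omega\subset\mathbb{R}^d$ be a bounded, open, connected (nonempty) set with Lipschitz boundary, and let $\nu>0$. For $(x,p)\in\overline\Omega\times\mathbb{R}^d$ let $H(x,p)=\sup_{|\alpha|\le 1}\alpha\cdot p$, let $F\equiv 0$ on $L^2(\Omega)$ and $G\equiv 1\in L^2(\Omega)\subset H^{-1}(\Omega)$, and write $e_1=(1,0,\dots,0)\in\mathbb{R}^d$. Definitions. Let $\partial_pH(x,p)$ be the set of $b\in\mathbb{R}^d$ with $H(x,q)\ge H(x,p)+b\cdot(q-p)$ for all $q\in\mathbb{R}^d$. A pair $(u,m)\in H^1_0(\Omega)\times H^1_0(\Omega)$ is a weak solution of the mean field game partial differential inclusion (PDI) if there is $b\in L^\infty(\Omega;\mathbb{R}^d)$ with $b(x)\in\partial_pH(x,\nabla u(x))$ for a.e. $x\in\Omega$ such that, for all $\psi,\phi\in H^1_0(\Omega)$, $$\int_\Omega \nu\nabla u\cdot\nabla\psi+H(x,\nabla u)\psi\,dx=\langle F[m],\psi\rangle,\qquad \int_\Omega \nu\nabla m\cdot\nabla\phi+m\,b\cdot\nabla\phi\,dx=\langle G,\phi\rangle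 .$$ A family $\{H_\lambda\}_{\lambda\in(0,1]}$ of real functions on $\overline\Omega\times\mathbb{R}^d$ is an admissible regularizing family (with Lipschitz constant $L_H=1$) if there is a continuous $\omega:[0,1]\to[0,\infty)$ with $\omega(0)=0$ such that, for every $\lambda\in(0,1]$: $H_\lambda$ is continuous; $|H_\lambda(x,p)-H_\lambda(x,q)|\le|p-q|$ for all $x\in\overline\Omega$ and $p,q\in\mathbb{R}^d$; $H_\lambda(x,\cdot)$ is convex for each $x\in\overline\Omega$; the partial derivative $\partial H_\lambda/\partial p$ exists and is continuous on $\overline\Omega\times\mathbb{R}^d$; and $|H_\lambda(x,p)-H(x,p)|\le\omega(\lambda)$ for all $(x,p)\in\overline\Omega\times\mathbb{R}^d$. The regularized problem with parameter $\lambda$ asks for $(u_\lambda,m_\lambda)\in H^1_0(\Omega)\times H^1_0(\Omega)$ such that, for all $\psi,\phi\in H^1_0(\Omega)$, $$\int_\Omega \nu\nabla u_\lambda\cdot\nabla\psi+H_\lambda(x,\nabla u_\lambda)\psi\,dx=\langle F[m_\lambda],\psi\rangle,\qquad \int_\Omega \nu\nabla m_\lambda\cdot\nabla\phi+m_\lambda\,\frac{\partial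 H_\lambda}{\partial p}(x,\nabla u_\lambda)\cdot\nabla\phi\,dx=\langle G,\phi\rangle .$$ Claim. $H(x,p)=|p|$ for all $(x,p)\in\overline\Omega\times\mathbb{R}^d$, and there exist an admissible regularizing family $\{H_\lambda\}_{\lambda\in(0,1]}$, numbers $\lambda_j\in(0,1]$ ($j=0,1,2,\dots$) with $\lambda_j\to0$, and two distinct $m_1,m_2\in H^1_0(\Omega)$, $m_1\ne m_2$, such that: (i) $(0,m_1)$ and $(0,m_2)$ are both weak solutions of the PDI, and $m_1$, $m_2$ solve its second equation with the constant drifts $b=e_1$ and $b=-e_1$, respectively; (ii) for every $j$, the regularized problem with $\lambda=\lambda_j$ has a unique solution $(u_{\lambda_j},m_{\lambda_j})\in H^1_0(\Omega)\times H^1_0(\Omega)$; (iii) $m_{\lambda_{2k+1}}=m_1$ and $m_{\lambda_{2k}}=m_2$ for all $k=0,1,2,\dots$. In particular, $(u_{\lambda_{2k+1}},m_{\lambda_{2k+1}})\to(0,m_1)$ and $(u_{\lambda_{2k}},m_{\lambda_{2k}})\to(0,m_2)$ in $H^1_0(\Omega)\times H^1_0(\Omega)$ as $k\to\infty$, so different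 subsequences converge to different solutions of the PDI. -/

import Mathlib

open MeasureTheory Filter Topology Set
open scoped ContDiff Gradient

noncomputable section

namespace MFG

/-- The Euclidean space `ℝ^d`. -/
abbrev E (d : ℕ) : Type := EuclideanSpace ℝ (Fin d)

/-! ### Bounded Lipschitz domains -/

/-- `Ω` has a Lipschitz boundary: around each boundary point `z`, with respect to some unit
direction `n`, the set `Ω` is the strict subgraph of a Lipschitz function `γ` of the component of
`x` that is orthogonal to `n`. -/
def HasLipschitzBoundary {d : ℕ} (Ω : Set (E d)) : Prop :=
  ∀ z ∈ frontier Ω, ∃ n : E d, ‖n‖ = 1 ∧ ∃ (γ : E d → ℝ) (K : NNReal), LipschitzWith K γ ∧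
    ∃ r : ℝ, 0 < r ∧ ∀ x ∈ Metric.ball z r,
      (x ∈ Ω ↔ inner ℝ n x < γ (x - (inner ℝ n x) • n))

/-- A bounded, open, connected (in particular nonempty) set with Lipschitz boundary. -/
structure IsBoundedLipschitzDomain {d : ℕ} (Ω : Set (E d)) : Prop where
  isBounded : Bornology.IsBounded Ω
  isOpen : IsOpen Ω
  isConnected : IsConnected Ω
  lipschitz : HasLipschitzBoundary Ω

/-! ### Lebesgue and Sobolev spaces -/

/-- The real Hilbert space `L²(Ω)`. -/
abbrev L2 {d : ℕ} (Ω : Set (E d)) : Type := Lp ℝ 2 (volume.restrict Ω)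

/-- The real Hilbert space `L²(Ω; ℝ^d)`. -/
abbrev L2vec {d : ℕ} (Ω : Set (E d)) : Type := Lp (E d) 2 (volume.restrict Ω)

/-- The Hilbert space `L²(Ω) × L²(Ω; ℝ^d)` with the norm `(‖u‖² + ‖g‖²)^(1/2)`. A function of
`H¹(Ω)` is identified with the pair `(u, ∇u)` of this space; the norm of the pair is then the
`H¹(Ω)`-norm of `u`. -/
abbrev L2Pair {d : ℕ} (Ω : Set (E d)) : Type := WithLp 2 (L2 Ω × L2vec Ω)

/-- `φ ∈ C_c^∞(Ω)`. -/
structure IsTestFunction {d : ℕ} (Ω : Set (E d)) (φ : E d → ℝ) : Prop where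
  contDiff : ContDiff ℝ ∞ φ
  hasCompactSupport : HasCompactSupport φ
  tsupport_subset : tsupport φ ⊆ Ω

/-- The vector space of all pairs `(φ, ∇φ)` with `φ ∈ C_c^∞(Ω)`. -/
def testPairs {d : ℕ} (Ω : Set (E d)) : Submodule ℝ (L2Pair Ω) where
  carrier := {w | ∃ φ : E d → ℝ, IsTestFunction Ω φ ∧
    w.fst =ᵐ[volume.restrict Ω] φ ∧ w.snd =ᵐ[volume.restrict Ω] ∇ φ}
  zero_mem' := by
    refine ⟨0, ⟨contDiff_const, HasCompactSupport.zero, by simp [tsupport]⟩, ?_, ?_⟩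
    · exact Lp.coeFn_zero _ _ _
    · refine (Lp.coeFn_zero (E d) 2 (volume.restrict Ω)).trans (Eventually.of_forall fun x => ?_)
      exact (gradient_const (𝕜 := ℝ) x (0 : ℝ)).symm
  add_mem' := by
    rintro v w ⟨φ, hφ, h1, h2⟩ ⟨ψ, hψ, h3, h4⟩
    refine ⟨φ + ψ, ⟨hφ.contDiff.add hψ.contDiff, hφ.hasCompactSupport.add hψ.hasCompactSupport,
      (tsupport_add φ ψ).trans (union_subset hφ.tsupport_subset hψ.tsupport_subset)⟩, ?_, ?_⟩
    · filter_upwards [Lp.coeFn_add v.fst w.fst, h1, h3] with x a b c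
      rw [WithLp.add_fst, a]; simp [b, c]
    · filter_upwards [Lp.coeFn_add v.snd w.snd, h2, h4] with x a b c
      rw [WithLp.add_snd, a, Pi.add_apply, b, c]
      have e1 := (hφ.contDiff.differentiable (by simp)) x
      have e2 := (hψ.contDiff.differentiable (by simp)) x
      simp [gradient, fderiv_add e1 e2]
  smul_mem' := by
    rintro c w ⟨φ, hφ, h1, h2⟩
    refine ⟨c • φ, ⟨contDiff_const.smul hφ.contDiff, hφ.hasCompactSupport.smul_left (f := fun _ => c),
      (closure_mono (Function.support_const_smul_subset c φ)).trans hφ.tsupport_subset⟩, ?_, ?_⟩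
    · filter_upwards [Lp.coeFn_smul c w.fst, h1] with x a b
      rw [WithLp.smul_fst, a]; simp [b]
    · filter_upwards [Lp.coeFn_smul c w.snd, h2] with x a b
      rw [WithLp.smul_snd, a, Pi.smul_apply, b]
      have e1 := (hφ.contDiff.differentiable (by simp)) x
      simp [gradient, fderiv_const_smul e1 c]

/-- The Sobolev space `H¹₀(Ω)`: the closure of `C_c^∞(Ω)` for the `H¹(Ω)`-norm. Its elements are
the pairs `(u, ∇u)`. -/
def H10 {d : ℕ} (Ω : Set (E d)) : Submodule ℝ (L2Pair Ω) := (testPairs Ω).topologicalClosure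

/-- The underlying function of `u ∈ H¹₀(Ω)`. -/
def fn {d : ℕ} {Ω : Set (E d)} (u : H10 Ω) : E d → ℝ := u.1.fst

/-- The gradient of `u ∈ H¹₀(Ω)`. -/
def grad {d : ℕ} {Ω : Set (E d)} (u : H10 Ω) : E d → E d := u.1.snd

/-- `g` is the weak gradient of `u` in `Ω`. -/
def IsWeakGradient {d : ℕ} (Ω : Set (E d)) (u : E d → ℝ) (g : E d → E d) : Prop :=
  ∀ φ : E d → ℝ, IsTestFunction Ω φ → ∀ v : E d,
    ∫ x in Ω, u x * inner ℝ (∇ φ x) v = - ∫ x in Ω, inner ℝ (g x) v * φ x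

/-- The second component of an element of `H¹₀(Ω)` is the weak gradient of the first one. -/
theorem isWeakGradient_grad {d : ℕ} {Ω : Set (E d)} (u : H10 Ω) :
    IsWeakGradient Ω (fn u) (grad u) := by
  intro φ hφ v
  have hφd : Differentiable ℝ φ := hφ.contDiff.differentiable (by simp)
  have hφc : Continuous φ := hφ.contDiff.continuous
  have hin : ∀ (f : E d → ℝ) (x : E d), inner ℝ (∇ f x) v = fderiv ℝ f x v := by
    intro f x; simp [gradient]
  have hDc : ∀ f : E d → ℝ, ContDiff ℝ ∞ f → Continuous (fun x => fderiv ℝ f x v) := fun f hf =>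
    (hf.continuous_fderiv (by simp)).clm_apply continuous_const
  have hDs : ∀ f : E d → ℝ, HasCompactSupport f → HasCompactSupport (fun x => fderiv ℝ f x v) :=
    fun f hf => hf.fderiv_apply (𝕜 := ℝ) v
  have m1 : MemLp (fun x => fderiv ℝ φ x v) 2 (volume.restrict Ω) :=
    ((hDc φ hφ.contDiff).memLp_of_hasCompactSupport (hDs φ hφ.hasCompactSupport)).restrict Ω
  have m2 : MemLp (fun x => φ x • v) 2 (volume.restrict Ω) :=
    ((hφc.smul continuous_const).memLp_of_hasCompactSupport
      (hφ.hasCompactSupport.smul_right (f' := fun _ => v))).restrict Ω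
  have key : ∀ w : L2Pair Ω, inner ℝ (m1.toLp _) w.fst + inner ℝ (m2.toLp _) w.snd =
      (∫ x in Ω, w.fst x * inner ℝ (∇ φ x) v) + ∫ x in Ω, inner ℝ (w.snd x) v * φ x := by
    intro w
    rw [L2.inner_def, L2.inner_def]
    congr 1
    · refine integral_congr_ae ?_
      filter_upwards [m1.coeFn_toLp] with x hx
      rw [hx, hin]; simp
    · refine integral_congr_ae ?_
      filter_upwards [m2.coeFn_toLp] with x hx
      rw [hx, inner_smul_left, real_inner_comm]; simp [mul_comm]
  have hcl : ∀ w ∈ (H10 Ω : Set (L2Pair Ω)),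
      inner ℝ (m1.toLp _) w.fst + inner ℝ (m2.toLp _) w.snd = 0 := by
    intro w hw
    refine closure_minimal (s := (testPairs Ω : Set (L2Pair Ω)))
      (t := {w | inner ℝ (m1.toLp _) w.fst + inner ℝ (m2.toLp _) w.snd = 0}) ?_ ?_ hw
    · rintro w ⟨f, hf, h1, h2⟩
      simp only [Set.mem_ofPred_eq]
      rw [key w]
      have e1 : ∫ x in Ω, w.fst x * inner ℝ (∇ φ x) v = ∫ x, f x * fderiv ℝ φ x v := by
        rw [← setIntegral_eq_integral_of_forall_compl_eq_zero (s := Ω)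
          (f := fun x => f x * fderiv ℝ φ x v)]
        · refine integral_congr_ae ?_
          filter_upwards [h1] with x hx
          rw [hx, hin]
        · intro x hx
          rw [image_eq_zero_of_notMem_tsupport fun h => hx (hf.tsupport_subset h), zero_mul]
      have e2 : ∫ x in Ω, inner ℝ (w.snd x) v * φ x = ∫ x, fderiv ℝ f x v * φ x := by
        rw [← setIntegral_eq_integral_of_forall_compl_eq_zero (s := Ω)
          (f := fun x => fderiv ℝ f x v * φ x)]
        · refine integral_congr_ae ?_
          filter_upwards [h2] with x hx
          rw [hx, hin]
        · intro x hx
          rw [image_eq_zero_of_notMem_tsupport fun h => hx (hφ.tsupport_subset h), mul_zero]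
      have hfc := hf.contDiff.continuous
      rw [e1, e2, integral_mul_fderiv_eq_neg_fderiv_mul_of_integrable
        (((hDc f hf.contDiff).mul hφc).integrable_of_hasCompactSupport
          hφ.hasCompactSupport.mul_left)
        ((hfc.mul (hDc φ hφ.contDiff)).integrable_of_hasCompactSupport
          hf.hasCompactSupport.mul_right)
        ((hfc.mul hφc).integrable_of_hasCompactSupport hf.hasCompactSupport.mul_right)
        (fun x _ => hf.contDiff.differentiable (by simp) x) (fun x _ => hφd x)]
      ring
    · exact isClosed_eq (by fun_prop) continuous_const
  have := hcl u.1 u.2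
  rw [key] at this
  exact eq_neg_of_add_eq_zero_left this

/-- The dual space `H⁻¹(Ω)` of `H¹₀(Ω)`. -/
abbrev Hm1 {d : ℕ} (Ω : Set (E d)) : Type := StrongDual ℝ (H10 Ω)

/-- The embedding `L²(Ω) ⊂ H⁻¹(Ω)`, `⟨g, φ⟩ = ∫_Ω g φ`. -/
def L2.toHm1 {d : ℕ} {Ω : Set (E d)} (g : L2 Ω) : Hm1 Ω :=
  (innerSL ℝ g).comp ((WithLp.fstL 2 ℝ (L2 Ω) (L2vec Ω)).comp (H10 Ω).subtypeL)

/-- The constant function `c`, as an element of `L²(Ω)`, for bounded `Ω`. -/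
def constL2 {d : ℕ} {Ω : Set (E d)} (hΩ : Bornology.IsBounded Ω) (c : ℝ) : L2 Ω :=
  MemLp.toLp (fun _ => c) <| by
    have : IsFiniteMeasure (volume.restrict Ω) :=
      isFiniteMeasure_restrict.2 hΩ.measure_lt_top.ne
    exact memLp_const c

/-! ### Hamiltonians and their regularizations -/

/-- The Hamiltonian `H(x,p) = sup_{α ∈ A} (b(x,α) · p - f(x,α))` with control set `A`. -/
def hamiltonian {d : ℕ} {A : Type*} (b : E d → A → E d) (f : E d → A → ℝ) (x p : E d) : ℝ :=
  ⨆ α : A, (inner ℝ (b x α) p - f x α)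

/-- The Hamiltonian `H(x,p) = sup_{|α| ≤ 1} α · p`. -/
def unitBallHamiltonian (d : ℕ) : E d → E d → ℝ :=
  hamiltonian (A := Metric.closedBall (0 : E d) 1) (fun _ α => α.1) (fun _ _ => 0)

/-- The pointwise subdifferential `∂_p H(x,p)`. -/
def subdifferential {d : ℕ} (H : E d → E d → ℝ) (x p : E d) : Set (E d) :=
  {b | ∀ q : E d, H x p + inner ℝ b (q - p) ≤ H x q}

/-- The set `D_pH[v]` of the vector fields `b ∈ L^∞(Ω; ℝ^d)` with `b(x) ∈ ∂_p H(x, ∇v(x))` for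
almost every `x ∈ Ω`, as a function of the gradient field `g = ∇v`. -/
def DpH {d : ℕ} (Ω : Set (E d)) (H : E d → E d → ℝ) (g : E d → E d) : Set (E d → E d) :=
  {b | MemLp b ⊤ (volume.restrict Ω) ∧
    ∀ᵐ x ∂(volume.restrict Ω), b x ∈ subdifferential H x (g x)}

/-- The admissibility hypothesis on a family `(Hreg l)`, `l ∈ (0,1]`, of regularizations of the
Hamiltonian `H` on `closure Ω × ℝ^d`, where `L` is a Lipschitz constant of `H` in `p`. -/
def IsRegularizingFamily {d : ℕ} (Ω : Set (E d)) (H : E d → E d → ℝ) (L : ℝ)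
    (Hreg : ℝ → E d → E d → ℝ) : Prop :=
  ∃ w : ℝ → ℝ, ContinuousOn w (Icc 0 1) ∧ (∀ s ∈ Icc (0 : ℝ) 1, 0 ≤ w s) ∧ w 0 = 0 ∧
    ∀ l ∈ Ioc (0 : ℝ) 1,
      ContinuousOn (fun z : E d × E d => Hreg l z.1 z.2) (closure Ω ×ˢ univ) ∧
      (∀ x ∈ closure Ω, ∀ p q : E d, |Hreg l x p - Hreg l x q| ≤ L * ‖p - q‖) ∧
      (∀ x ∈ closure Ω, ConvexOn ℝ univ (Hreg l x)) ∧
      (∀ x ∈ closure Ω, Differentiable ℝ (Hreg l x)) ∧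
      ContinuousOn (fun z : E d × E d => ∇ (Hreg l z.1) z.2) (closure Ω ×ˢ univ) ∧
      (∀ x ∈ closure Ω, ∀ p : E d, |Hreg l x p - H x p| ≤ w l)

/-! ### Weak solutions -/

/-- `u ∈ H¹₀(Ω)` is a weak solution of `-ν Δu + H(x, ∇u) = f`, where `f ∈ H⁻¹(Ω)`. -/
def IsWeakHJB {d : ℕ} {Ω : Set (E d)} (ν : ℝ) (H : E d → E d → ℝ) (f : Hm1 Ω) (u : H10 Ω) : Prop :=
  ∀ ψ : H10 Ω, ∫ x in Ω, (ν * inner ℝ (grad u x) (grad ψ x) + H x (grad u x) * fn ψ x) = f ψ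

/-- `m ∈ H¹₀(Ω)` is a weak solution of `-ν Δm - div(m b) = G`, where `G ∈ H⁻¹(Ω)`. -/
def IsWeakKFP {d : ℕ} {Ω : Set (E d)} (ν : ℝ) (b : E d → E d) (G : Hm1 Ω) (m : H10 Ω) : Prop :=
  ∀ φ : H10 Ω, ∫ x in Ω, (ν * inner ℝ (grad m x) (grad φ x) +
    fn m x * inner ℝ (b x) (grad φ x)) = G φ

/-- `(u, m)` is a weak solution of the mean field game partial differential inclusion
`-ν Δu + H(x, ∇u) = F[m]`, `-ν Δm - G ∈ div(m ∂_p H(x, ∇u))`, with homogeneous Dirichlet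
conditions. -/
def IsWeakSolutionPDI {d : ℕ} {Ω : Set (E d)} (ν : ℝ) (H : E d → E d → ℝ) (F : L2 Ω → Hm1 Ω)
    (G : Hm1 Ω) (u m : H10 Ω) : Prop :=
  ∃ b ∈ DpH Ω H (grad u), IsWeakHJB ν H (F m.1.fst) u ∧ IsWeakKFP ν b G m

/-- `(u, m)` is a weak solution of the mean field game system
`-ν Δu + H(x, ∇u) = F[m]`, `-ν Δm - div(m ∂H/∂p(x, ∇u)) = G`, with homogeneous Dirichlet
conditions, for a Hamiltonian `H` that is differentiable in `p`. -/
def IsWeakSolutionPDE {d : ℕ} {Ω : Set (E d)} (ν : ℝ) (H : E d → E d → ℝ) (F : L2 Ω → Hm1 Ω)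
    (G : Hm1 Ω) (u m : H10 Ω) : Prop :=
  IsWeakHJB ν H (F m.1.fst) u ∧ IsWeakKFP ν (fun x => ∇ (H x) (grad u x)) G m

end MFG

end

/-! At `p = 0` the subdifferential of the norm is the whole closed unit ball, so with `u = 0` every
constant unit drift is admissible in the inclusion. A regularization can select any such drift `s`:
the Huber function is shifted by `l • s` and normalized to vanish at `0`, so its gradient at `0` is
exactly `s`. Then `u = 0` solves the regularized HJB equation and the density equation has drift
`s`. Letting `s` alternate between `e₁` and `-e₁` along `lam j` makes the densities alternate.

The main work is uniqueness for the regularized system (`eq_zero_of_isWeakHJB_of_isWeakKFP`). Write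
`K` for the convex Hamiltonian and `P` for its gradient. Testing the HJB equation for `v` with a
density and the density equation with `v` cancels the diffusion
(`integral_mul_eq_of_isWeakHJB_of_isWeakKFP`). With the density of the system, convexity gives `∫ v
≥ 0`. With an auxiliary density of constant drift `P 0` and source `1 + 1_{v > 0}`, it gives `∫ (v +
v⁺) ≤ 0`. Together these force `v = 0`. Both signs need nonnegative densities (`IsWeakKFP.nonneg`).

Constant drifts are skew on `H10`, so Lax–Milgram solves their equations uniquely. If opposite
drifts shared a density, its derivative along the drift would vanish, and Poincaré in that direction
would make the density zero, against the source `1`. -/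

noncomputable section

namespace MFG

/-! ### Convex regularizations of the norm -/

section Huber

variable {V : Type*} [NormedAddCommGroup V] [InnerProductSpace ℝ V]

theorem convexOn_of_subgradient {f : V → ℝ} {P : V → V}
    (h : ∀ p q, f p + inner ℝ (P p) (q - p) ≤ f q) : ConvexOn ℝ univ f := by
  refine ⟨convex_univ, fun x _ y _ a b ha hb hab => ?_⟩
  have h1 := h (a • x + b • y) x
  have h2 := h (a • x + b • y) y
  have h3 : a * inner ℝ (P (a • x + b • y)) (x - (a • x + b • y)) +
      b * inner ℝ (P (a • x + b • y)) (y - (a • x + b • y)) = 0 := by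
    rw [← inner_smul_right, ← inner_smul_right, ← inner_add_right]
    have : a • (x - (a • x + b • y)) + b • (y - (a • x + b • y)) = 0 := by
      obtain rfl : b = 1 - a := by linarith
      module
    rw [this, inner_zero_right]
  have h4 : f (a • x + b • y) = a * f (a • x + b • y) + b * f (a • x + b • y) := by
    rw [← add_mul, hab, one_mul]
  simp only [smul_eq_mul]
  nlinarith [mul_le_mul_of_nonneg_left h1 ha, mul_le_mul_of_nonneg_left h2 hb]

theorem abs_sub_le_of_subgradient {f : V → ℝ} {P : V → V}
    (h : ∀ p q, f p + inner ℝ (P p) (q - p) ≤ f q) (hP : ∀ p, ‖P p‖ ≤ 1) (p q : V) :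
    |f p - f q| ≤ ‖p - q‖ := by
  have key : ∀ p q, f p - f q ≤ ‖p - q‖ := fun p q => by
    have h1 := h p q
    have h2 := abs_real_inner_le_norm (P p) (q - p)
    have h3 := mul_le_mul_of_nonneg_right (hP p) (norm_nonneg (q - p))
    rw [norm_sub_rev p q]
    linarith [neg_abs_le (inner ℝ (P p) (q - p))]
  rw [abs_le]
  have := key q p
  rw [norm_sub_rev] at this
  exact ⟨by linarith, key p q⟩

/-- The subgradient inequalities at `p` and at `q` squeeze the first-order remainder between `0` and
`⟪P q - P p, q - p⟫`, which is `o(‖q - p‖)` by continuity of `P`. -/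
theorem hasGradientAt_of_subgradient [CompleteSpace V] {f : V → ℝ} {P : V → V}
    (h : ∀ p q, f p + inner ℝ (P p) (q - p) ≤ f q) (hP : Continuous P) (p : V) :
    HasGradientAt f (P p) p := by
  rw [hasGradientAt_iff_isLittleO, Asymptotics.isLittleO_iff]
  intro c hc
  have : ∀ᶠ q in 𝓝 p, ‖P q - P p‖ < c := by
    have := (hP.tendsto p).sub_const (P p)
    rw [sub_self] at this
    have := this.norm
    rw [norm_zero] at this
    exact this.eventually (gt_mem_nhds hc)
  filter_upwards [this] with q hq
  have h1 := h p q
  have h2 := h q p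
  have h3 := real_inner_le_norm (P q - P p) (q - p)
  have h4 := mul_le_mul_of_nonneg_right hq.le (norm_nonneg (q - p))
  have h5 : inner ℝ (P q) (p - q) = - inner ℝ (P q) (q - p) := by
    rw [← inner_neg_right, neg_sub]
  rw [inner_sub_left] at h3
  rw [Real.norm_eq_abs, abs_le]
  constructor <;> linarith [mul_nonneg hc.le (norm_nonneg (q - p))]

/-- The projection of `p / l` onto the closed unit ball. -/
def ballProj (l : ℝ) (p : V) : V := (max l ‖p‖)⁻¹ • p

/-- The Moreau envelope of the norm (the Huber function). -/
def huber (l : ℝ) (p : V) : ℝ := inner ℝ (ballProj l p) p - l / 2 * ‖ballProj l p‖ ^ 2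

theorem norm_ballProj_le {l : ℝ} (hl : 0 < l) (p : V) : ‖ballProj l p‖ ≤ 1 := by
  have h0 : 0 < max l ‖p‖ := lt_max_of_lt_left hl
  rw [ballProj, norm_smul, norm_inv, Real.norm_of_nonneg h0.le, inv_mul_le_one₀ h0]
  exact le_max_right _ _

theorem continuous_ballProj {l : ℝ} (hl : 0 < l) : Continuous (ballProj l : V → V) := by
  unfold ballProj
  exact ((continuous_const.max continuous_norm).inv₀ fun p => (lt_max_of_lt_left hl).ne').smul
    continuous_id

/-- This makes `huber l` a supremum of affine functions over the unit ball, attained at `ballProj l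
p`; the subgradient property and both comparisons with the norm follow from it. -/
theorem inner_sub_le_huber {l : ℝ} (hl : 0 < l) {a : V} (ha : ‖a‖ ≤ 1) (p : V) :
    inner ℝ a p - l / 2 * ‖a‖ ^ 2 ≤ huber l p := by
  have h1 := real_inner_le_norm a p
  have hp := norm_nonneg p
  have h0 := norm_nonneg a
  rcases le_total ‖p‖ l with h | h
  · have e : huber l p = ‖p‖ ^ 2 / (2 * l) := by
      rw [huber, ballProj, max_eq_left h, norm_smul, inner_smul_left, real_inner_self_eq_norm_sq,
        norm_inv, Real.norm_of_nonneg hl.le]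
      simp only [conj_trivial]
      field_simp
      ring
    rw [e, le_div_iff₀ (by positivity)]
    nlinarith [sq_nonneg (‖p‖ - l * ‖a‖)]
  · have hp' : 0 < ‖p‖ := hl.trans_le h
    have e : huber l p = ‖p‖ - l / 2 := by
      rw [huber, ballProj, max_eq_right h, norm_smul, inner_smul_left, real_inner_self_eq_norm_sq,
        norm_inv, norm_norm]
      simp only [conj_trivial]
      field_simp
    rw [e]
    -- After Cauchy–Schwarz the gap is at least `(1 - ‖a‖) (‖p‖ - l) + l / 2 * (1 - ‖a‖) ^ 2`.
    nlinarith [mul_nonneg (sub_nonneg.2 ha) (sub_nonneg.2 h),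
      mul_nonneg (mul_nonneg (sub_nonneg.2 ha) (sub_nonneg.2 ha)) hl.le]

theorem huber_subgradient {l : ℝ} (hl : 0 < l) (p q : V) :
    huber l p + inner ℝ (ballProj l p) (q - p) ≤ huber l q := by
  have := inner_sub_le_huber hl (norm_ballProj_le hl p) q
  rw [inner_sub_right]
  unfold huber at *
  linarith

theorem huber_le_norm {l : ℝ} (hl : 0 < l) (p : V) : huber l p ≤ ‖p‖ := by
  have h1 := real_inner_le_norm (ballProj l p) p
  have h2 := mul_le_mul_of_nonneg_right (norm_ballProj_le hl p) (norm_nonneg p)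
  unfold huber
  nlinarith [sq_nonneg ‖ballProj l p‖]

theorem norm_le_huber_add {l : ℝ} (hl : 0 < l) (p : V) : ‖p‖ ≤ huber l p + l / 2 := by
  -- The competitor is the direction of `p`; for `p = 0` it is the zero vector, which is also
  -- allowed.
  have h1 : ‖‖p‖⁻¹ • p‖ ≤ 1 := by
    rw [norm_smul, norm_inv, norm_norm]
    exact inv_mul_le_one
  have h := inner_sub_le_huber hl h1 p
  have h2 : inner ℝ (‖p‖⁻¹ • p) p = ‖p‖ := by
    rw [inner_smul_left, real_inner_self_eq_norm_sq]
    rcases eq_or_ne ‖p‖ 0 with h0 | h0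
    · simp [h0]
    · simp only [conj_trivial]
      field_simp
  rw [h2] at h
  nlinarith [pow_le_one₀ (n := 2) (norm_nonneg (‖p‖⁻¹ • p)) h1]

/-- A regularization of the norm that vanishes at `0` and has gradient `s` there, if `‖s‖ = 1`. -/
def tiltedHuber (l : ℝ) (s p : V) : ℝ := huber l (p + l • s) - huber l (l • s)

theorem tiltedHuber_zero (l : ℝ) (s : V) : tiltedHuber l s 0 = 0 := by simp [tiltedHuber]

theorem tiltedHuber_subgradient {l : ℝ} (hl : 0 < l) (s p q : V) :
    tiltedHuber l s p + inner ℝ (ballProj l (p + l • s)) (q - p) ≤ tiltedHuber l s q := by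
  have := huber_subgradient hl (p + l • s) (q + l • s)
  rw [add_sub_add_right_eq_sub] at this
  unfold tiltedHuber
  linarith

theorem continuous_ballProj_add {l : ℝ} (hl : 0 < l) (s : V) :
    Continuous fun p : V => ballProj l (p + l • s) :=
  (continuous_ballProj hl).comp (continuous_id.add continuous_const)

theorem hasGradientAt_tiltedHuber [CompleteSpace V] {l : ℝ} (hl : 0 < l) (s p : V) :
    HasGradientAt (tiltedHuber l s) (ballProj l (p + l • s)) p :=
  hasGradientAt_of_subgradient (tiltedHuber_subgradient hl s) (continuous_ballProj_add hl s) p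

theorem ballProj_smul {l : ℝ} (hl : 0 < l) {s : V} (hs : ‖s‖ = 1) : ballProj l (l • s) = s := by
  rw [ballProj, norm_smul, hs, Real.norm_of_nonneg hl.le, mul_one, max_self, smul_smul,
    inv_mul_cancel₀ hl.ne', one_smul]

theorem abs_tiltedHuber_sub_le {l : ℝ} (hl : 0 < l) (s p q : V) :
    |tiltedHuber l s p - tiltedHuber l s q| ≤ ‖p - q‖ :=
  abs_sub_le_of_subgradient (tiltedHuber_subgradient hl s) (fun _ => norm_ballProj_le hl _) p q

theorem continuous_tiltedHuber [CompleteSpace V] {l : ℝ} (hl : 0 < l) (s : V) :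
    Continuous (tiltedHuber l s) :=
  continuous_iff_continuousAt.2 fun p => (hasGradientAt_tiltedHuber hl s p).continuousAt

theorem abs_tiltedHuber_sub_norm_le {l : ℝ} (hl : 0 < l) {s : V} (hs : ‖s‖ = 1) (p : V) :
    |tiltedHuber l s p - ‖p‖| ≤ 3 * l := by
  have e : ‖l • s‖ = l := by rw [norm_smul, hs, Real.norm_of_nonneg hl.le, mul_one]
  have h1 := norm_le_huber_add hl (p + l • s)
  have h2 := huber_le_norm hl (p + l • s)
  have h3 := norm_le_huber_add hl (l • s)
  have h4 := huber_le_norm hl (l • s)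
  have h5 := norm_add_le p (l • s)
  have h6 := norm_sub_le (p + l • s) (l • s)
  rw [add_sub_cancel_right] at h6
  rw [e] at *
  unfold tiltedHuber
  rw [abs_le]
  constructor <;> linarith

end Huber

/-! ### The Hamiltonian and its admissible regularizations -/

theorem unitBallHamiltonian_eq_norm {d : ℕ} (x p : E d) : unitBallHamiltonian d x p = ‖p‖ := by
  unfold unitBallHamiltonian hamiltonian
  have hle : ∀ α : Metric.closedBall (0 : E d) 1, inner ℝ α.1 p - 0 ≤ ‖p‖ := fun α => by
    have h1 := real_inner_le_norm α.1 p
    have h2 := mul_le_mul_of_nonneg_right (mem_closedBall_zero_iff.1 α.2) (norm_nonneg p)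
    linarith
  have : Nonempty (Metric.closedBall (0 : E d) 1) := ⟨⟨0, by simp⟩⟩
  refine le_antisymm (ciSup_le hle) ?_
  have h1 : ‖‖p‖⁻¹ • p‖ ≤ 1 := by
    rw [norm_smul, norm_inv, norm_norm]
    exact inv_mul_le_one
  refine le_trans (le_of_eq ?_) (le_ciSup (f := fun α : Metric.closedBall (0 : E d) 1 =>
    inner ℝ α.1 p - 0) ⟨‖p‖, by rintro _ ⟨α, rfl⟩; exact hle α⟩
    ⟨‖p‖⁻¹ • p, mem_closedBall_zero_iff.2 h1⟩)
  rw [sub_zero, inner_smul_left, real_inner_self_eq_norm_sq]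
  rcases eq_or_ne ‖p‖ 0 with h0 | h0
  · simp [h0]
  · simp only [conj_trivial]
    field_simp

/-- Admissibility constrains each parameter separately, apart from the common modulus `3 * l`, so
the tilt `s` may depend on `l` without any continuity. -/
theorem isRegularizingFamily_tiltedHuber {d : ℕ} (Ω : Set (E d)) {s : ℝ → E d}
    (hs : ∀ l, ‖s l‖ = 1) :
    IsRegularizingFamily Ω (unitBallHamiltonian d) 1 fun l _ p => tiltedHuber l (s l) p := by
  refine ⟨fun l => 3 * l, by fun_prop, fun l hl => by linarith [hl.1], by simp,
    fun l hl => ⟨?_, ?_, ?_, ?_, ?_, ?_⟩⟩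
  · exact ((continuous_tiltedHuber hl.1 _).comp continuous_snd).continuousOn
  · intro x _ p q
    rw [one_mul]
    exact abs_tiltedHuber_sub_le hl.1 _ p q
  · intro x _
    exact convexOn_of_subgradient (tiltedHuber_subgradient hl.1 _)
  · intro x _ p
    exact (hasGradientAt_tiltedHuber hl.1 _ p).differentiableAt
  · simp only [fun p => (hasGradientAt_tiltedHuber hl.1 (s l) p).gradient]
    exact ((continuous_ballProj_add hl.1 _).comp continuous_snd).continuousOn
  · intro x _ p
    rw [unitBallHamiltonian_eq_norm]
    exact abs_tiltedHuber_sub_norm_le hl.1 (hs l) p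

/-! ### Convergence in `L²` and the chain rule in `H10` -/

theorem L2.norm_sq_eq_integral {α V : Type*} [MeasurableSpace α] {μ : Measure α}
    [NormedAddCommGroup V] [InnerProductSpace ℝ V] (f : Lp V 2 μ) :
    ‖f‖ ^ 2 = ∫ x, ‖f x‖ ^ 2 ∂μ := by
  rw [← real_inner_self_eq_norm_sq, L2.inner_def]
  simp only [real_inner_self_eq_norm_sq]

theorem L2.tendsto_of_dominated {α V : Type*} [MeasurableSpace α] {μ : Measure α}
    [NormedAddCommGroup V] [InnerProductSpace ℝ V] {f : ℕ → Lp V 2 μ} {g : Lp V 2 μ}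
    {bound : α → ℝ} (hb : Integrable (fun x => bound x ^ 2) μ)
    (h : ∀ n, ∀ᵐ x ∂μ, ‖f n x - g x‖ ≤ bound x)
    (hlim : ∀ᵐ x ∂μ, Tendsto (fun n => f n x) atTop (𝓝 (g x))) :
    Tendsto f atTop (𝓝 g) := by
  rw [tendsto_iff_norm_sub_tendsto_zero]
  have h1 : Tendsto (fun n => ‖f n - g‖ ^ 2) atTop (𝓝 0) := by
    have e : ∀ n, ‖f n - g‖ ^ 2 = ∫ x, ‖f n x - g x‖ ^ 2 ∂μ := fun n => by
      rw [L2.norm_sq_eq_integral]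
      refine integral_congr_ae ?_
      filter_upwards [Lp.coeFn_sub (f n) g] with x hx
      rw [hx, Pi.sub_apply]
    simp only [e]
    have h0 : (0 : ℝ) = ∫ _, (0 : ℝ) ∂μ := by simp
    rw [h0]
    refine tendsto_integral_of_dominated_convergence (fun x => bound x ^ 2) (fun n => ?_) hb
      (fun n => ?_) ?_
    · exact ((Lp.aestronglyMeasurable (f n)).sub (Lp.aestronglyMeasurable g)).norm.pow 2
    · filter_upwards [h n] with x hx
      rw [norm_pow, norm_norm]
      gcongr
    · filter_upwards [hlim] with x hx
      have := ((hx.sub_const (g x)).norm.pow 2)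
      simpa using this
  have h2 := h1.sqrt
  simpa [Real.sqrt_sq (norm_nonneg _)] using h2

variable {d : ℕ} {Ω : Set (E d)}

/-- Composition with `f` maps test functions to test functions because `f 0 = 0`, and the claim
passes to the closure. It supplies the nonlinear test function of the minimum principle. -/
theorem exists_chain_rule {f : ℝ → ℝ} (hf : ContDiff ℝ ∞ f) (h0 : f 0 = 0) {K : ℝ}
    (hK : ∀ t, |deriv f t| ≤ K) (u : H10 Ω) :
    ∃ v : H10 Ω, fn v =ᵐ[volume.restrict Ω] (fun x => f (fn u x)) ∧
      grad v =ᵐ[volume.restrict Ω] fun x => deriv f (fn u x) • grad u x := by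
  have hfd : Differentiable ℝ f := hf.differentiable (by simp)
  have hdc : Continuous (deriv f) := hf.continuous_deriv (by simp)
  have hK0 : 0 ≤ K := (abs_nonneg _).trans (hK 0)
  have hlip : ∀ a b, |f a - f b| ≤ K * |a - b| := fun a b =>
    convex_univ.norm_image_sub_le_of_norm_deriv_le (fun x _ => hfd x) (fun x _ => hK x)
      (mem_univ b) (mem_univ a)
  have hm1 : ∀ a : L2 Ω, MemLp (fun x => f (a x)) 2 (volume.restrict Ω) := fun a =>
    MemLp.of_le_mul (c := K) (Lp.memLp a)
      (hf.continuous.comp_aestronglyMeasurable (Lp.aestronglyMeasurable a))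
      (Eventually.of_forall fun x => by simpa [h0] using hlip (a x) 0)
  have hm2 : ∀ (a : L2 Ω) (g : L2vec Ω),
      MemLp (fun x => deriv f (a x) • g x) 2 (volume.restrict Ω) := fun a g =>
    MemLp.of_le_mul (c := K) (Lp.memLp g)
      ((hdc.comp_aestronglyMeasurable (Lp.aestronglyMeasurable a)).smul
        (Lp.aestronglyMeasurable g))
      (Eventually.of_forall fun x => by
        rw [norm_smul]
        exact mul_le_mul_of_nonneg_right (hK _) (norm_nonneg _))
  obtain ⟨w, hw, hwu⟩ := mem_closure_iff_seq_limit.1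
    (show u.1 ∈ closure (testPairs Ω : Set (L2Pair Ω)) from u.2)
  have hfst : Tendsto (fun n => (w n).fst) atTop (𝓝 u.1.fst) :=
    ((WithLp.fstL 2 ℝ (L2 Ω) (L2vec Ω)).continuous.tendsto u.1).comp hwu
  have hsnd : Tendsto (fun n => (w n).snd) atTop (𝓝 u.1.snd) :=
    ((WithLp.sndL 2 ℝ (L2 Ω) (L2vec Ω)).continuous.tendsto u.1).comp hwu
  -- Almost everywhere convergence along a subsequence is needed to pass to the limit inside `deriv
  -- f`.
  obtain ⟨ns, hns, hae⟩ := (tendstoInMeasure_of_tendsto_Lp hfst).exists_seq_tendsto_ae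
  replace hfst := hfst.comp hns.tendsto_atTop
  replace hsnd := hsnd.comp hns.tendsto_atTop
  let A : ℕ → L2Pair Ω := fun n => WithLp.toLp 2 ((hm1 (w (ns n)).fst).toLp _,
    (hm2 (w (ns n)).fst (w (ns n)).snd).toLp _)
  let z : L2Pair Ω := WithLp.toLp 2 ((hm1 u.1.fst).toLp _, (hm2 u.1.fst u.1.snd).toLp _)
  have hA : ∀ n, A n ∈ testPairs Ω := by
    intro n
    obtain ⟨φ, hφ, h1, h2⟩ := hw (ns n)
    refine ⟨f ∘ φ, ⟨hf.comp hφ.contDiff, hφ.hasCompactSupport.comp_left h0,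
      (tsupport_comp_subset h0 φ).trans hφ.tsupport_subset⟩, ?_, ?_⟩
    · filter_upwards [(hm1 (w (ns n)).fst).coeFn_toLp, h1] with x hx hx1
      exact hx.trans (by rw [hx1, Function.comp])
    · filter_upwards [(hm2 (w (ns n)).fst (w (ns n)).snd).coeFn_toLp, h1, h2] with x hx hx1 hx2
      refine hx.trans ?_
      rw [hx1, hx2]
      have e := (hfd (φ x)).hasDerivAt.comp_hasFDerivAt x
        ((hφ.contDiff.differentiable (by simp)) x).hasFDerivAt
      rw [gradient, gradient, e.fderiv, map_smul]
  have hAz : Tendsto A atTop (𝓝 z) := by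
    refine ((WithLp.prod_continuous_toLp 2 (L2 Ω) (L2vec Ω)).tendsto _).comp
      (Tendsto.prodMk_nhds ?_ ?_)
    · rw [tendsto_iff_norm_sub_tendsto_zero] at hfst ⊢
      refine squeeze_zero (fun _ => norm_nonneg _) (fun n => ?_)
        (by simpa using hfst.const_mul K)
      refine Lp.norm_le_mul_norm_of_ae_le_mul ?_
      filter_upwards [(hm1 (w (ns n)).fst).coeFn_toLp, (hm1 u.1.fst).coeFn_toLp,
        Lp.coeFn_sub ((hm1 (w (ns n)).fst).toLp _) ((hm1 u.1.fst).toLp _),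
        Lp.coeFn_sub (w (ns n)).fst u.1.fst] with x e1 e2 e3 e4
      rw [e3, Pi.sub_apply, e1, e2]
      refine le_of_le_of_eq (b := K * |(w (ns n)).fst x - u.1.fst x|) ?_ (by
        rw [e4, Pi.sub_apply, Real.norm_eq_abs])
      exact hlip _ _
    -- The gradients are split as `f'(wₙ) (∇wₙ - ∇u) + f'(wₙ) ∇u`: the first term is bounded by `K
    -- ‖∇wₙ - ∇u‖`, and the second converges by domination.
    · have hC : Tendsto (fun n => (hm2 (w (ns n)).fst u.1.snd).toLp _) atTop
          (𝓝 ((hm2 u.1.fst u.1.snd).toLp _)) := by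
        refine L2.tendsto_of_dominated (bound := fun x => 2 * K * ‖u.1.snd x‖) ?_ ?_ ?_
        · simp only [mul_pow]
          exact ((memLp_two_iff_integrable_sq_norm (Lp.aestronglyMeasurable _)).1
            (Lp.memLp u.1.snd)).const_mul _
        · intro n
          filter_upwards [(hm2 (w (ns n)).fst u.1.snd).coeFn_toLp,
            (hm2 u.1.fst u.1.snd).coeFn_toLp] with x e1 e2
          rw [e1, e2, ← sub_smul, norm_smul]
          refine mul_le_mul_of_nonneg_right ((norm_sub_le _ _).trans ?_) (norm_nonneg _)
          rw [two_mul]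
          exact add_le_add (hK _) (hK _)
        · filter_upwards [hae, ae_all_iff.2 fun n => (hm2 (w (ns n)).fst u.1.snd).coeFn_toLp,
            (hm2 u.1.fst u.1.snd).coeFn_toLp] with x e0 e1 e2
          rw [e2]
          simp only [e1]
          exact ((hdc.tendsto _).comp e0).smul_const _
      have hAC : Tendsto (fun n => (hm2 (w (ns n)).fst (w (ns n)).snd).toLp _ -
          (hm2 (w (ns n)).fst u.1.snd).toLp _) atTop (𝓝 0) := by
        rw [tendsto_iff_norm_sub_tendsto_zero] at hsnd
        rw [tendsto_zero_iff_norm_tendsto_zero]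
        refine squeeze_zero (fun _ => norm_nonneg _) (fun n => ?_)
          (by simpa using hsnd.const_mul K)
        refine Lp.norm_le_mul_norm_of_ae_le_mul ?_
        filter_upwards [(hm2 (w (ns n)).fst (w (ns n)).snd).coeFn_toLp,
          (hm2 (w (ns n)).fst u.1.snd).coeFn_toLp,
          Lp.coeFn_sub ((hm2 (w (ns n)).fst (w (ns n)).snd).toLp _)
            ((hm2 (w (ns n)).fst u.1.snd).toLp _),
          Lp.coeFn_sub (w (ns n)).snd u.1.snd] with x e1 e2 e3 e4
        rw [e3, Pi.sub_apply, e1, e2]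
        refine le_of_le_of_eq (b := K * ‖(w (ns n)).snd x - u.1.snd x‖) ?_ (by
        rw [e4, Pi.sub_apply])
        rw [← smul_sub, norm_smul]
        exact mul_le_mul_of_nonneg_right (hK _) (norm_nonneg _)
      simpa using hAC.add hC
  refine ⟨⟨z, mem_closure_of_tendsto hAz (Eventually.of_forall hA)⟩, ?_, ?_⟩
  · exact (hm1 u.1.fst).coeFn_toLp
  · exact (hm2 u.1.fst u.1.snd).coeFn_toLp

/-! ### Directional derivatives and a one-directional Poincaré inequality -/

/-- The component in direction `c` of a square integrable vector field. -/
def comp (Ω : Set (E d)) (c : E d) : L2vec Ω →L[ℝ] L2 Ω :=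
  (innerSL ℝ c).compLpL 2 (volume.restrict Ω)

theorem coeFn_comp (c : E d) (g : L2vec Ω) :
    comp Ω c g =ᵐ[volume.restrict Ω] fun x => inner ℝ c (g x) := by
  filter_upwards [ContinuousLinearMap.coeFn_compLpL (innerSL ℝ c) g] with x hx
  simpa [comp] using hx

theorem norm_comp_le (c : E d) (g : L2vec Ω) : ‖comp Ω c g‖ ≤ ‖c‖ * ‖g‖ := by
  refine Lp.norm_le_mul_norm_of_ae_le_mul ?_
  filter_upwards [coeFn_comp c g] with x hx
  rw [hx]
  exact norm_inner_le_norm c (g x)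

theorem setIntegral_eq_of_tsupport_subset {f : E d → ℝ} (hf : tsupport f ⊆ Ω) :
    ∫ x in Ω, f x = ∫ x, f x :=
  setIntegral_eq_integral_of_forall_compl_eq_zero fun _ hx =>
    image_eq_zero_of_notMem_tsupport fun h => hx (hf h)

theorem inner_gradient_eq (c : E d) (φ : E d → ℝ) (x : E d) :
    inner ℝ c (∇ φ x) = fderiv ℝ φ x c := by
  rw [inner_gradient_right]; simp

theorem IsTestFunction.differentiable {φ : E d → ℝ} (hφ : IsTestFunction Ω φ) :
    Differentiable ℝ φ := hφ.contDiff.differentiable (by simp)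

theorem IsTestFunction.continuous_fderiv_apply {φ : E d → ℝ} (hφ : IsTestFunction Ω φ) (c : E d) :
    Continuous fun x => fderiv ℝ φ x c :=
  (hφ.contDiff.continuous_fderiv (by simp)).clm_apply continuous_const

theorem tsupport_mul_left_subset {f g : E d → ℝ} (hf : tsupport f ⊆ Ω) :
    tsupport (fun x => f x * g x) ⊆ Ω :=
  (tsupport_mul_subset_left (f := f) (g := g)).trans hf

/-- The integrand is half the `c`-derivative of a square. Hence a constant drift drops out of the
energy identity. -/
theorem inner_comp_self (c : E d) {w : L2Pair Ω} (hw : w ∈ H10 Ω) :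
    inner ℝ w.fst (comp Ω c w.snd) = 0 := by
  refine closure_minimal (s := (testPairs Ω : Set (L2Pair Ω)))
      (t := {w | inner ℝ w.fst (comp Ω c w.snd) = 0}) ?_ ?_ hw
  · rintro w ⟨φ, hφ, h1, h2⟩
    simp only [Set.mem_ofPred_eq]
    have e : inner ℝ w.fst (comp Ω c w.snd) = ∫ x in Ω, φ x * fderiv ℝ φ x c := by
      rw [L2.inner_def]
      refine integral_congr_ae ?_
      filter_upwards [h1, h2, coeFn_comp c w.snd] with x e1 e2 e3
      rw [e1, e3, e2, inner_gradient_eq]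
      simp [mul_comm]
    rw [e, setIntegral_eq_of_tsupport_subset (tsupport_mul_left_subset hφ.tsupport_subset)]
    have hi : Integrable (fun x => φ x * fderiv ℝ φ x c) :=
      (hφ.contDiff.continuous.mul (hφ.continuous_fderiv_apply c)).integrable_of_hasCompactSupport
        hφ.hasCompactSupport.mul_right
    have := integral_mul_fderiv_eq_neg_fderiv_mul_of_integrable (v := c) (f := φ) (g := φ)
      (μ := volume) (by simpa only [mul_comm] using hi) hi
      ((hφ.contDiff.continuous.mul hφ.contDiff.continuous).integrable_of_hasCompactSupport
        hφ.hasCompactSupport.mul_right)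
      (fun x _ => hφ.differentiable x) (fun x _ => hφ.differentiable x)
    simp only [mul_comm (fderiv ℝ φ _ c)] at this
    linarith
  · exact isClosed_eq (by fun_prop) continuous_const

/-- Since `⟪c, x⟫` has `c`-derivative `1`, integration by parts turns `∫ φ²` into `-∫ 2 ⟪c, x⟫ φ
∂_cφ`, and Young's inequality absorbs half of `∫ φ²`. Having only `∂_c` on the right is what the
comparison of opposite drifts uses. -/
theorem poincare {c : E d} (hc : ‖c‖ = 1) {R : ℝ} (hR : ∀ x ∈ Ω, ‖x‖ ≤ R) {w : L2Pair Ω}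
    (hw : w ∈ H10 Ω) : ‖w.fst‖ ^ 2 ≤ 4 * R ^ 2 * ‖comp Ω c w.snd‖ ^ 2 := by
  refine closure_minimal (s := (testPairs Ω : Set (L2Pair Ω)))
      (t := {w | ‖w.fst‖ ^ 2 ≤ 4 * R ^ 2 * ‖comp Ω c w.snd‖ ^ 2}) ?_ ?_ hw
  · rintro w ⟨φ, hφ, h1, h2⟩
    simp only [Set.mem_ofPred_eq]
    have hφc := hφ.contDiff.continuous
    have hDc := hφ.continuous_fderiv_apply c
    have hDs : HasCompactSupport fun x => fderiv ℝ φ x c := hφ.hasCompactSupport.fderiv_apply ℝ c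
    have hDt : tsupport (fun x => fderiv ℝ φ x c) ⊆ Ω :=
      (tsupport_fderiv_apply_subset ℝ c).trans hφ.tsupport_subset
    have e1 : ‖w.fst‖ ^ 2 = ∫ x, φ x * φ x := by
      rw [L2.norm_sq_eq_integral,
        ← setIntegral_eq_of_tsupport_subset (tsupport_mul_left_subset hφ.tsupport_subset)]
      refine integral_congr_ae ?_
      filter_upwards [h1] with x hx
      rw [hx, Real.norm_eq_abs, sq_abs, sq]
    have e2 : ‖comp Ω c w.snd‖ ^ 2 = ∫ x, fderiv ℝ φ x c * fderiv ℝ φ x c := by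
      rw [L2.norm_sq_eq_integral,
        ← setIntegral_eq_of_tsupport_subset (tsupport_mul_left_subset hDt)]
      refine integral_congr_ae ?_
      filter_upwards [h2, coeFn_comp c w.snd] with x hx hx'
      rw [hx', hx, inner_gradient_eq, Real.norm_eq_abs, sq_abs, sq]
    rw [e1, e2]
    have hsq : ∀ x, fderiv ℝ (fun x => φ x * φ x) x c = 2 * (φ x * fderiv ℝ φ x c) := fun x => by
      rw [fderiv_fun_mul (hφ.differentiable x) (hφ.differentiable x)]
      simp
      ring
    have hlin : ∀ x, fderiv ℝ (fun x : E d => inner ℝ c x) x c = 1 := fun x => by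
      have : HasFDerivAt (fun x : E d => inner ℝ c x) (innerSL ℝ c) x :=
        (innerSL ℝ c).hasFDerivAt
      rw [this.fderiv]
      simp [hc]
    have hlc : Continuous fun x : E d => inner ℝ c x := by fun_prop
    have hlin_d : Differentiable ℝ fun x : E d => inner ℝ c x := (innerSL ℝ c).differentiable
    have hφφ : Integrable fun x => φ x * φ x :=
      (hφc.mul hφc).integrable_of_hasCompactSupport hφ.hasCompactSupport.mul_right
    have hDD : Integrable fun x => fderiv ℝ φ x c * fderiv ℝ φ x c :=
      (hDc.mul hDc).integrable_of_hasCompactSupport hDs.mul_right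
    have hxD : Integrable fun x => inner ℝ c x * (2 * (φ x * fderiv ℝ φ x c)) :=
      (hlc.mul (continuous_const.mul (hφc.mul hDc))).integrable_of_hasCompactSupport
        hφ.hasCompactSupport.mul_right.mul_left.mul_left
    have key := integral_mul_fderiv_eq_neg_fderiv_mul_of_integrable (v := c)
      (f := fun x : E d => inner ℝ c x) (g := fun x => φ x * φ x) (μ := volume)
      (by simpa only [hlin, one_mul] using hφφ) (by simpa only [hsq] using hxD)
      ((hlc.mul (hφc.mul hφc)).integrable_of_hasCompactSupport
        hφ.hasCompactSupport.mul_right.mul_left)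
      (fun x _ => hlin_d x) (fun x _ => (hφ.differentiable x).mul (hφ.differentiable x))
    simp only [hsq, hlin, one_mul] at key
    have hpt : ∀ x, -(inner ℝ c x * (2 * (φ x * fderiv ℝ φ x c))) ≤
        1 / 2 * (φ x * φ x) + 2 * R ^ 2 * (fderiv ℝ φ x c * fderiv ℝ φ x c) := fun x => by
      by_cases hx : x ∈ Ω
      · have h3 : (inner ℝ c x) ^ 2 ≤ R ^ 2 := by
          rw [← sq_abs]
          have := abs_real_inner_le_norm c x
          rw [hc, one_mul] at this
          gcongr
          exact this.trans (hR x hx)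
        nlinarith [sq_nonneg (φ x + 2 * inner ℝ c x * fderiv ℝ φ x c),
          mul_le_mul_of_nonneg_right h3 (mul_self_nonneg (fderiv ℝ φ x c))]
      · rw [image_eq_zero_of_notMem_tsupport fun h => hx (hφ.tsupport_subset h)]
        simp only [zero_mul, mul_zero, neg_zero, zero_add]
        exact mul_nonneg (by positivity) (mul_self_nonneg _)
    have hmono := integral_mono hxD.neg
      ((hφφ.const_mul (1 / 2)).add (hDD.const_mul (2 * R ^ 2))) hpt
    simp only [Pi.neg_apply, Pi.add_apply] at hmono
    rw [integral_neg, integral_add (hφφ.const_mul _) (hDD.const_mul _), integral_const_mul,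
      integral_const_mul] at hmono
    linarith
  · exact isClosed_le (by fun_prop) (by fun_prop)

/-! ### The density equation with constant drift -/

instance : CompleteSpace (H10 Ω) :=
  (Submodule.isClosed_topologicalClosure (testPairs Ω)).completeSpace_coe

theorem H10.ext_ae {u v : H10 Ω} (h : fn u =ᵐ[volume.restrict Ω] fn v)
    (h' : grad u =ᵐ[volume.restrict Ω] grad v) : u = v := by
  apply Subtype.ext
  apply WithLp.ofLp_injective 2
  exact Prod.ext (Lp.ext h) (Lp.ext h')

theorem fn_zero_ae : fn (0 : H10 Ω) =ᵐ[volume.restrict Ω] 0 := Lp.coeFn_zero _ _ _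

theorem grad_zero_ae : grad (0 : H10 Ω) =ᵐ[volume.restrict Ω] 0 := Lp.coeFn_zero _ _ _

theorem memLp_fn (u : H10 Ω) : MemLp (fn u) 2 (volume.restrict Ω) := Lp.memLp _

theorem memLp_grad (u : H10 Ω) : MemLp (grad u) 2 (volume.restrict Ω) := Lp.memLp _

theorem integrable_inner_grad (u v : H10 Ω) :
    Integrable (fun x => inner ℝ (grad u x) (grad v x)) (volume.restrict Ω) :=
  L2.integrable_inner u.1.snd v.1.snd

/-- The bilinear form `(m, φ) ↦ ∫ ν ∇m · ∇φ + m c · ∇φ` on `H¹₀(Ω)`, for a constant drift `c`. -/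
def driftForm (Ω : Set (E d)) (ν : ℝ) (c : E d) : H10 Ω →L[ℝ] H10 Ω →L[ℝ] ℝ :=
  let J : H10 Ω →L[ℝ] L2 Ω := (WithLp.fstL 2 ℝ (L2 Ω) (L2vec Ω)).comp (H10 Ω).subtypeL
  let D : H10 Ω →L[ℝ] L2vec Ω := (WithLp.sndL 2 ℝ (L2 Ω) (L2vec Ω)).comp (H10 Ω).subtypeL
  ν • (innerSL ℝ).bilinearComp D D + (innerSL ℝ).bilinearComp J ((comp Ω c).comp D)

theorem driftForm_apply (ν : ℝ) (c : E d) (m φ : H10 Ω) :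
    driftForm Ω ν c m φ =
      ν * inner ℝ m.1.snd φ.1.snd + inner ℝ m.1.fst (comp Ω c φ.1.snd) := rfl

theorem integrable_drift {b : E d → E d} (hb : AEStronglyMeasurable b (volume.restrict Ω))
    (hb1 : ∀ x, ‖b x‖ ≤ 1) (m φ : H10 Ω) :
    Integrable (fun x => fn m x * inner ℝ (b x) (grad φ x)) (volume.restrict Ω) := by
  refine MemLp.integrable_mul (p := 2) (q := 2) (memLp_fn m) ?_
  refine MemLp.of_le_mul (c := 1) (memLp_grad φ) (hb.inner (memLp_grad φ).1)
    (Eventually.of_forall fun x => ?_)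
  exact (norm_inner_le_norm _ _).trans (mul_le_mul_of_nonneg_right (hb1 x) (norm_nonneg _))

theorem driftForm_eq_integral (ν : ℝ) {c : E d} (hc : ‖c‖ = 1) (m φ : H10 Ω) :
    driftForm Ω ν c m φ =
      ∫ x in Ω, (ν * inner ℝ (grad m x) (grad φ x) + fn m x * inner ℝ c (grad φ x)) := by
  rw [driftForm_apply, L2.inner_def, L2.inner_def, integral_add
    ((integrable_inner_grad m φ).const_mul ν)
    (integrable_drift aestronglyMeasurable_const (fun _ => hc.le) m φ), integral_const_mul]
  congr 1
  refine integral_congr_ae ?_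
  filter_upwards [coeFn_comp c φ.1.snd] with x hx
  rw [hx]
  simp [fn, grad, mul_comm]

theorem isWeakKFP_const_iff {ν : ℝ} {c : E d} (hc : ‖c‖ = 1) {G : Hm1 Ω} {m : H10 Ω} :
    IsWeakKFP ν (fun _ => c) G m ↔ ∀ φ, driftForm Ω ν c m φ = G φ := by
  simp only [IsWeakKFP, driftForm_eq_integral ν hc]

theorem driftForm_self (ν : ℝ) (c : E d) (u : H10 Ω) :
    driftForm Ω ν c u u = ν * ‖u.1.snd‖ ^ 2 := by
  rw [driftForm_apply, inner_comp_self c u.2, real_inner_self_eq_norm_sq, add_zero]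

theorem isCoercive_driftForm (hΩ : Bornology.IsBounded Ω) {ν : ℝ} (hν : 0 < ν) {c : E d}
    (hc : ‖c‖ = 1) : IsCoercive (driftForm Ω ν c) := by
  obtain ⟨R, hR⟩ := hΩ.exists_norm_le
  -- By Poincaré, the squared `H10` norm is at most `(4 * R ^ 2 + 1)` times that of the gradient.
  refine ⟨ν / (4 * R ^ 2 + 1), by positivity, fun u => ?_⟩
  have h1 := poincare hc hR u.2
  have h2 := norm_comp_le c u.1.snd
  rw [hc, one_mul] at h2
  have h3 : ‖u‖ ^ 2 = ‖u.1.fst‖ ^ 2 + ‖u.1.snd‖ ^ 2 := WithLp.prod_norm_sq_eq_of_L2 u.1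
  have h4 : ‖comp Ω c u.1.snd‖ ^ 2 ≤ ‖u.1.snd‖ ^ 2 := by gcongr
  rw [driftForm_self, mul_assoc, ← sq, div_mul_eq_mul_div, div_le_iff₀ (by positivity), mul_assoc]
  refine mul_le_mul_of_nonneg_left ?_ hν.le
  nlinarith [mul_le_mul_of_nonneg_left h4 (sq_nonneg R)]

theorem exists_isWeakKFP_const (hΩ : Bornology.IsBounded Ω) {ν : ℝ} (hν : 0 < ν) {c : E d}
    (hc : ‖c‖ = 1) (G : Hm1 Ω) : ∃ m : H10 Ω, IsWeakKFP ν (fun _ => c) G m := by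
  have hco := isCoercive_driftForm hΩ hν hc
  refine ⟨hco.continuousLinearEquivOfBilin.symm ((InnerProductSpace.toDual ℝ (H10 Ω)).symm G), ?_⟩
  rw [isWeakKFP_const_iff hc]
  intro φ
  rw [← hco.continuousLinearEquivOfBilin_apply, ContinuousLinearEquiv.apply_symm_apply,
    InnerProductSpace.toDual_symm_apply]

theorem IsWeakKFP.unique_const (hΩ : Bornology.IsBounded Ω) {ν : ℝ} (hν : 0 < ν) {c : E d}
    (hc : ‖c‖ = 1) {G : Hm1 Ω} {m n : H10 Ω} (hm : IsWeakKFP ν (fun _ => c) G m)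
    (hn : IsWeakKFP ν (fun _ => c) G n) : m = n := by
  rw [isWeakKFP_const_iff hc] at hm hn
  obtain ⟨C, hC, h⟩ := isCoercive_driftForm hΩ hν hc
  have h0 : driftForm Ω ν c (m - n) (m - n) = 0 := by
    rw [(driftForm Ω ν c).map_sub m n]
    exact sub_eq_zero.2 ((hm _).trans (hn _).symm)
  have h1 := h (m - n)
  rw [h0, mul_assoc, ← sq] at h1
  have h2 : ‖m - n‖ ^ 2 ≤ 0 := nonpos_of_mul_nonpos_right h1 hC
  exact sub_eq_zero.1 (norm_eq_zero.1 (pow_eq_zero_iff two_ne_zero |>.1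
    (le_antisymm h2 (sq_nonneg _))))

theorem IsWeakKFP.congr_ae {ν : ℝ} {b b' : E d → E d} {G : Hm1 Ω} {m : H10 Ω}
    (h : b =ᵐ[volume.restrict Ω] b') (hm : IsWeakKFP ν b G m) : IsWeakKFP ν b' G m := by
  intro φ
  rw [← hm φ]
  refine integral_congr_ae ?_
  filter_upwards [h] with x hx
  rw [hx]

theorem toHm1_apply (g : L2 Ω) (φ : H10 Ω) : L2.toHm1 g φ = ∫ x in Ω, g x * fn φ x := by
  change inner ℝ g φ.1.fst = _
  rw [L2.inner_def]
  simp [fn, mul_comm]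

theorem coeFn_constL2 (hΩ : Bornology.IsBounded Ω) (c : ℝ) :
    constL2 hΩ c =ᵐ[volume.restrict Ω] fun _ => c := MemLp.coeFn_toLp _

/-! ### Minimum principle for bounded drifts -/

theorem hasDerivAt_expNegInvGlue (x : ℝ) :
    HasDerivAt expNegInvGlue (x⁻¹ ^ 2 * expNegInvGlue x) x := by
  simpa using expNegInvGlue.hasDerivAt_polynomial_eval_inv_mul 1 x

theorem sq_mul_expNegInvGlue_le (x : ℝ) : x⁻¹ ^ 2 * expNegInvGlue x ≤ 2 := by
  rcases le_or_gt x 0 with hx | hx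
  · rw [expNegInvGlue.zero_of_nonpos hx, mul_zero]; norm_num
  · rw [expNegInvGlue, if_neg hx.not_ge, Real.exp_neg, ← div_eq_mul_inv,
      div_le_iff₀ (Real.exp_pos _)]
    have := Real.quadratic_le_exp_of_nonneg (inv_pos.2 hx).le
    have := inv_pos.2 hx
    linarith

/-- Weak minimum principle: test with `-exp (2ν / m)` on `{m < 0}`. -/
theorem IsWeakKFP.nonneg (hΩ : Bornology.IsBounded Ω) {ν : ℝ} (hν : 0 < ν) {b : E d → E d}
    (hb : AEStronglyMeasurable b (volume.restrict Ω)) (hb1 : ∀ x, ‖b x‖ ≤ 1) {g : L2 Ω}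
    (hg : ∀ᵐ x ∂volume.restrict Ω, 1 ≤ g x) {m : H10 Ω} (h : IsWeakKFP ν b (L2.toHm1 g) m) :
    ∀ᵐ x ∂volume.restrict Ω, 0 ≤ fn m x := by
  have : IsFiniteMeasure (volume.restrict Ω) := isFiniteMeasure_restrict.2 hΩ.measure_lt_top.ne
  set f : ℝ → ℝ := fun t => -expNegInvGlue (-t / (2 * ν)) with hf
  have hfs : ContDiff ℝ ∞ f :=
    (expNegInvGlue.contDiff.comp (contDiff_neg.div_const (2 * ν))).neg
  have hd : ∀ t, deriv f t =
      (2 * ν)⁻¹ * ((-t / (2 * ν))⁻¹ ^ 2 * expNegInvGlue (-t / (2 * ν))) := fun t => by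
    have := ((hasDerivAt_expNegInvGlue (-t / (2 * ν))).comp t
      ((hasDerivAt_neg t).div_const (2 * ν))).neg
    refine this.deriv.trans ?_
    ring
  have hd0 : ∀ t, 0 ≤ deriv f t := fun t => by
    rw [hd]
    have := expNegInvGlue.nonneg (-t / (2 * ν))
    positivity
  -- This differential equation dictates the choice of `f`: it lets the error from the drift be
  -- absorbed by the source.
  have hdsq : ∀ t, deriv f t * t ^ 2 = -2 * ν * f t := fun t => by
    rw [hd, hf]
    rcases eq_or_ne t 0 with rfl | ht
    · simp
    · field_simp
  obtain ⟨v, hv, hv'⟩ := exists_chain_rule (K := (2 * ν)⁻¹ * 2) hfs (by simp [hf]) (fun t => by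
    rw [abs_of_nonneg (hd0 t), hd]
    exact mul_le_mul_of_nonneg_left (sq_mul_expNegInvGlue_le _) (by positivity)) m
  have hvi : Integrable (fn v) (volume.restrict Ω) := (memLp_fn v).integrable one_le_two
  have hvn : ∀ᵐ x ∂volume.restrict Ω, fn v x ≤ 0 := by
    filter_upwards [hv] with x hx
    rw [hx]
    exact neg_nonpos.2 (expNegInvGlue.nonneg _)
  have h1 := h v
  rw [toHm1_apply] at h1
  have h2 : ∫ x in Ω, g x * fn v x ≤ ∫ x in Ω, fn v x := by
    refine integral_mono_ae ((Lp.memLp g).integrable_mul (memLp_fn v)) hvi ?_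
    filter_upwards [hg, hvn] with x hx hx'
    nlinarith
  -- Completing the square in `b · ∇m` costs `f'(m) m² / (4ν)`, which is exactly `-f(m) / 2`. With
  -- `h2` this gives `½ ∫ f(m) ≤ ∫ f(m)`, and `f ≤ 0` then forces `f(m) = 0`.
  have h3 : ∫ x in Ω, 1 / 2 * fn v x ≤
      ∫ x in Ω, (ν * inner ℝ (grad m x) (grad v x) + fn m x * inner ℝ (b x) (grad v x)) := by
    refine integral_mono_ae (hvi.const_mul _) (((integrable_inner_grad m v).const_mul ν).add
      (integrable_drift hb hb1 m v)) ?_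
    filter_upwards [hv, hv'] with x hx hx'
    rw [hx, hx', inner_smul_right, inner_smul_right, real_inner_self_eq_norm_sq]
    have e1 := hd0 (fn m x)
    have e2 := hdsq (fn m x)
    have e3 : (inner ℝ (b x) (grad m x)) ^ 2 ≤ ‖grad m x‖ ^ 2 := by
      rw [← sq_abs]
      gcongr
      exact (abs_real_inner_le_norm _ _).trans
        (mul_le_of_le_one_left (norm_nonneg _) (hb1 x))
    generalize inner ℝ (b x) (grad m x) = q at *
    generalize deriv f (fn m x) = D at *
    have e4 : f (fn m x) = -(D * fn m x ^ 2) / (2 * ν) := by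
      rw [e2]; field_simp
    have e5 : 0 ≤ D * (2 * ν * q + fn m x) ^ 2 / (4 * ν) := by positivity
    have e6 : D * (2 * ν * q + fn m x) ^ 2 / (4 * ν) =
        ν * D * q ^ 2 + D * (fn m x * q) + (D * fn m x ^ 2) / (4 * ν) := by
      field_simp; ring
    have e7 := mul_le_mul_of_nonneg_left e3 (mul_nonneg hν.le e1)
    have e8 : 1 / 2 * (-(D * fn m x ^ 2) / (2 * ν)) = -((D * fn m x ^ 2) / (4 * ν)) := by
      field_simp; ring
    rw [e4, e8]
    linarith
  rw [integral_const_mul] at h3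
  have h4 : ∫ x in Ω, -fn v x = 0 := by
    refine le_antisymm ?_ (integral_nonneg_of_ae ?_)
    · rw [integral_neg]; linarith
    · filter_upwards [hvn] with x hx
      simpa using hx
  have h5 : -fn v =ᵐ[volume.restrict Ω] 0 := (integral_eq_zero_iff_of_nonneg_ae
    (by filter_upwards [hvn] with x hx; simpa using hx) hvi.neg).1 h4
  filter_upwards [h5, hv] with x hx hx'
  rw [Pi.neg_apply, hx', hf, Pi.zero_apply, neg_neg, expNegInvGlue.zero_iff_nonpos, div_le_iff₀ (by positivity)]
    at hx
  linarith

/-! ### Uniqueness for the HJB equation by duality -/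

theorem integral_mul_eq_of_isWeakHJB_of_isWeakKFP {ν : ℝ} {K : E d → ℝ} (hK : Continuous K)
    (hK1 : ∀ p, |K p| ≤ ‖p‖) {b : E d → E d}
    (hb : AEStronglyMeasurable b (volume.restrict Ω)) (hb1 : ∀ x, ‖b x‖ ≤ 1) {g : L2 Ω}
    {v m : H10 Ω} (hv : IsWeakHJB ν (fun _ => K) 0 v) (hm : IsWeakKFP ν b (L2.toHm1 g) m) :
    ∫ x in Ω, g x * fn v x = ∫ x in Ω, fn m x * (inner ℝ (b x) (grad v x) - K (grad v x)) := by
  have h1 : ∫ x in Ω, (ν * inner ℝ (grad v x) (grad m x) + K (grad v x) * fn m x) = 0 := hv m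
  have h2 := hm v
  have hKi : Integrable (fun x => K (grad v x) * fn m x) (volume.restrict Ω) :=
    MemLp.integrable_mul (p := 2) (q := 2) (MemLp.of_le_mul (c := 1) (memLp_grad v)
      (hK.comp_aestronglyMeasurable (memLp_grad v).1)
      (Eventually.of_forall fun x => by rw [one_mul]; exact hK1 _)) (memLp_fn m)
  rw [toHm1_apply] at h2
  have i1 : Integrable (fun x => ν * inner ℝ (grad m x) (grad v x) +
      fn m x * inner ℝ (b x) (grad v x)) (volume.restrict Ω) :=
    ((integrable_inner_grad m v).const_mul ν).add (integrable_drift hb hb1 m v)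
  have i2 : Integrable (fun x => ν * inner ℝ (grad v x) (grad m x) + K (grad v x) * fn m x)
      (volume.restrict Ω) := ((integrable_inner_grad v m).const_mul ν).add hKi
  rw [← h2, ← sub_zero (∫ x in Ω, _), ← h1, ← integral_sub i1 i2]
  refine integral_congr_ae (Eventually.of_forall fun x => ?_)
  simp only [real_inner_comm (grad v x) (grad m x)]
  ring

/-- Elements of `H10` are pairs, so the gradient component has to be shown to vanish too; testing
the equation with `v` itself does this. -/
theorem eq_zero_of_isWeakHJB_of_fn_eq_zero {ν : ℝ} (hν : 0 < ν) {K : E d → ℝ} {v : H10 Ω}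
    (hv : IsWeakHJB ν (fun _ => K) 0 v) (h : fn v =ᵐ[volume.restrict Ω] 0) : v = 0 := by
  have h1 : ∫ x in Ω, ν * inner ℝ (grad v x) (grad v x) = 0 := by
    have := hv v
    rw [zero_apply] at this
    rw [← this]
    refine integral_congr_ae ?_
    filter_upwards [h] with x hx
    simp [hx]
  rw [integral_const_mul] at h1
  have h2 : inner ℝ v.1.snd v.1.snd = 0 := by
    rw [L2.inner_def]
    exact (mul_eq_zero.1 h1).resolve_left hν.ne'
  have h3 : v.1.snd = 0 := inner_self_eq_zero.1 h2
  refine H10.ext_ae (h.trans fn_zero_ae.symm) ?_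
  rw [grad, h3]
  rfl

theorem ae_eq_zero_of_integral_add_max_nonpos {α : Type*} [MeasurableSpace α] {μ : Measure α}
    {f : α → ℝ} (hf : Integrable f μ) (h : 0 ≤ ∫ x, f x ∂μ)
    (h' : ∫ x, (f x + max (f x) 0) ∂μ ≤ 0) : f =ᵐ[μ] 0 := by
  have hp : Integrable (fun x => max (f x) 0) μ := hf.pos_part
  rw [integral_add hf hp] at h'
  have h0 : 0 ≤ fun x => max (f x) 0 := fun x => le_max_right _ _
  have h1 : 0 ≤ ∫ x, max (f x) 0 ∂μ := integral_nonneg h0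
  have h2 := (integral_eq_zero_iff_of_nonneg h0 hp).1 (by linarith)
  have h3 : 0 ≤ᵐ[μ] -f := by
    filter_upwards [h2] with x hx
    have := le_max_left (f x) 0
    rw [hx, Pi.zero_apply] at this
    simpa using this
  have h4 : ∫ x, (-f) x ∂μ = 0 := by
    refine le_antisymm ?_ (integral_nonneg_of_ae h3)
    simp only [Pi.neg_apply]
    rw [integral_neg]
    linarith
  filter_upwards [(integral_eq_zero_iff_of_nonneg_ae h3 hf.neg).1 h4] with x hx
  simpa using hx

/-- Uniqueness for the Hamilton–Jacobi–Bellman equation with vanishing right-hand side, given a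
solution of the adjoint equation; `P` is the gradient of the convex Hamiltonian `K`. -/
theorem eq_zero_of_isWeakHJB_of_isWeakKFP (hΩ : Bornology.IsBounded Ω) {ν : ℝ} (hν : 0 < ν)
    {K : E d → ℝ} {P : E d → E d} (hP : Continuous P) (hP1 : ∀ p, ‖P p‖ ≤ 1)
    (hKP : ∀ p q, K p + inner ℝ (P p) (q - p) ≤ K q) (hK0 : K 0 = 0) (hP0 : ‖P 0‖ = 1)
    {v n : H10 Ω} (hv : IsWeakHJB ν (fun _ => K) 0 v)
    (hn : IsWeakKFP ν (fun x => P (grad v x)) (L2.toHm1 (constL2 hΩ 1)) n) : v = 0 := by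
  have : IsFiniteMeasure (volume.restrict Ω) := isFiniteMeasure_restrict.2 hΩ.measure_lt_top.ne
  have hK : Continuous K :=
    continuous_iff_continuousAt.2 fun p => (hasGradientAt_of_subgradient hKP hP p).continuousAt
  have hK1 : ∀ p, |K p| ≤ ‖p‖ := fun p => by
    simpa [hK0] using abs_sub_le_of_subgradient hKP hP1 p 0
  have hb : AEStronglyMeasurable (fun x => P (grad v x)) (volume.restrict Ω) :=
    hP.comp_aestronglyMeasurable (memLp_grad v).1
  refine eq_zero_of_isWeakHJB_of_fn_eq_zero hν hv (ae_eq_zero_of_integral_add_max_nonpos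
    ((memLp_fn v).integrable one_le_two) ?_ ?_)
  · have e : ∫ x in Ω, fn v x = ∫ x in Ω, constL2 hΩ 1 x * fn v x := by
      refine integral_congr_ae ?_
      filter_upwards [coeFn_constL2 hΩ 1] with x hx
      rw [hx, one_mul]
    rw [e, integral_mul_eq_of_isWeakHJB_of_isWeakKFP hK hK1 hb (fun x => hP1 _) hv hn]
    -- The subgradient inequality at `∇v`, compared with `0`, gives `P(∇v) · ∇v ≥ K(∇v)`.
    refine integral_nonneg_of_ae ?_
    filter_upwards [hn.nonneg hΩ hν hb (fun x => hP1 _)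
      (by filter_upwards [coeFn_constL2 hΩ 1] with x hx; rw [hx])] with x hx
    refine mul_nonneg hx ?_
    have := hKP (grad v x) 0
    rw [hK0, zero_sub, inner_neg_right] at this
    linarith
  · have hms : MeasurableSet {x | 0 < fn v x} :=
      measurableSet_lt measurable_const (Lp.stronglyMeasurable v.1.fst).measurable
    have hgm : MemLp (fun x => (1 : ℝ) + {x | 0 < fn v x}.indicator (fun _ => (1 : ℝ)) x) 2
        (volume.restrict Ω) := by
      have h1 : MemLp (fun _ : E d => (1 : ℝ)) 2 (volume.restrict Ω) := memLp_const 1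
      exact h1.add (h1.indicator hms)
    obtain ⟨g, hg⟩ : ∃ g : L2 Ω, g =ᵐ[volume.restrict Ω]
        fun x => 1 + {x | 0 < fn v x}.indicator (fun _ => 1) x := ⟨hgm.toLp, hgm.coeFn_toLp⟩
    -- Linearizing at `0` reverses the convexity inequality and makes the drift the constant unit
    -- vector `P 0`, where existence is available. The summand `1` in `g` provides the lower bound
    -- for the minimum principle.
    obtain ⟨m, hm⟩ := exists_isWeakKFP_const hΩ hν hP0 (L2.toHm1 g)
    have e : ∫ x in Ω, (fn v x + max (fn v x) 0) = ∫ x in Ω, g x * fn v x := by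
      refine integral_congr_ae ?_
      filter_upwards [hg] with x hx
      rw [hx]
      by_cases h : 0 < fn v x
      · rw [indicator_of_mem (show x ∈ {x | 0 < fn v x} from h), max_eq_left h.le]
        ring
      · rw [indicator_of_notMem (show x ∉ {x | 0 < fn v x} from h), max_eq_right (not_lt.1 h)]
        ring
    rw [e, integral_mul_eq_of_isWeakHJB_of_isWeakKFP hK hK1 aestronglyMeasurable_const
      (fun _ => hP0.le) hv hm]
    refine integral_nonpos_of_ae ?_
    filter_upwards [hm.nonneg hΩ hν aestronglyMeasurable_const (fun _ => hP0.le) (by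
      filter_upwards [hg] with x hx
      rw [hx]
      exact le_add_of_nonneg_right (indicator_nonneg (fun _ _ => zero_le_one) x))] with x hx
    refine mul_nonpos_of_nonneg_of_nonpos hx ?_
    have := hKP 0 (grad v x)
    rw [hK0, sub_zero] at this
    linarith

/-! ### Opposite drifts have distinct densities -/

theorem IsTestFunction.exists_H10 {φ : E d → ℝ} (hφ : IsTestFunction Ω φ) :
    ∃ w : H10 Ω, fn w =ᵐ[volume.restrict Ω] φ ∧ grad w =ᵐ[volume.restrict Ω] ∇ φ := by
  have h1 : MemLp φ 2 (volume.restrict Ω) :=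
    (hφ.contDiff.continuous.memLp_of_hasCompactSupport hφ.hasCompactSupport).restrict Ω
  have hg : ∇ φ = fun x => (InnerProductSpace.toDual ℝ (E d)).symm (fderiv ℝ φ x) := rfl
  have h2 : MemLp (∇ φ) 2 (volume.restrict Ω) := by
    rw [hg]
    exact (((InnerProductSpace.toDual ℝ (E d)).symm.continuous.comp
      (hφ.contDiff.continuous_fderiv (by simp))).memLp_of_hasCompactSupport
      ((hφ.hasCompactSupport.fderiv ℝ).comp_left (map_zero _))).restrict Ω
  exact ⟨⟨WithLp.toLp 2 (h1.toLp _, h2.toLp _), subset_closure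
    ⟨φ, hφ, h1.coeFn_toLp, h2.coeFn_toLp⟩⟩, h1.coeFn_toLp, h2.coeFn_toLp⟩

theorem ae_eq_zero_of_forall_isTestFunction (hΩ : IsOpen Ω) {f : E d → ℝ}
    (hf : IntegrableOn f Ω) (h : ∀ φ, IsTestFunction Ω φ → ∫ x in Ω, f x * φ x = 0) :
    f =ᵐ[volume.restrict Ω] 0 := by
  refine (ae_restrict_iff' hΩ.measurableSet).2
    (hΩ.ae_eq_zero_of_integral_contDiff_smul_eq_zero hf.locallyIntegrableOn fun φ h1 h2 h3 => ?_)
  rw [← h φ ⟨h1, h2, h3⟩, ← setIntegral_eq_integral_of_forall_compl_eq_zero (s := Ω)]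
  · simp only [smul_eq_mul, mul_comm]
  · intro x hx
    rw [image_eq_zero_of_notMem_tsupport fun h => hx (h3 h), zero_smul]

/-- Opposite constant drifts give different densities. -/
theorem IsWeakKFP.ne_of_neg_drift (hΩ : Bornology.IsBounded Ω) (hΩo : IsOpen Ω)
    (hΩn : Ω.Nonempty) {ν : ℝ} {c : E d} (hc : ‖c‖ = 1) {m₁ m₂ : H10 Ω}
    (h₁ : IsWeakKFP ν (fun _ => c) (L2.toHm1 (constL2 hΩ 1)) m₁)
    (h₂ : IsWeakKFP ν (fun _ => -c) (L2.toHm1 (constL2 hΩ 1)) m₂) (hν : 0 < ν) : m₁ ≠ m₂ := by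
  rintro rfl
  have : IsFiniteMeasure (volume.restrict Ω) := isFiniteMeasure_restrict.2 hΩ.measure_lt_top.ne
  rw [isWeakKFP_const_iff hc] at h₁
  rw [isWeakKFP_const_iff (by rwa [norm_neg])] at h₂
  -- Subtracting the two equations leaves only twice the drift term.
  have h3 : ∀ φ : H10 Ω, inner ℝ m₁.1.fst (comp Ω c φ.1.snd) = 0 := fun φ => by
    have e1 := h₁ φ
    have e2 := h₂ φ
    rw [driftForm_apply] at e1 e2
    have e3 : comp Ω (-c) φ.1.snd = -comp Ω c φ.1.snd := by
      apply Lp.ext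
      filter_upwards [coeFn_comp c φ.1.snd, coeFn_comp (-c) φ.1.snd,
        Lp.coeFn_neg (comp Ω c φ.1.snd)] with x a1 a2 a3
      rw [a2, a3, Pi.neg_apply, a1, inner_neg_left]
    rw [e3, inner_neg_right] at e2
    linarith
  have h4 : comp Ω c m₁.1.snd = 0 := by
    apply Lp.ext
    refine (ae_eq_zero_of_forall_isTestFunction hΩo
      ((Lp.memLp (comp Ω c m₁.1.snd)).integrable one_le_two) fun φ hφ => ?_).trans
      (Lp.coeFn_zero _ _ _).symm
    obtain ⟨w, _, hw⟩ := hφ.exists_H10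
    have e1 := isWeakGradient_grad m₁ φ hφ c
    have e2 := h3 w
    rw [L2.inner_def] at e2
    have e3 : ∫ x in Ω, fn m₁ x * inner ℝ (∇ φ x) c = 0 := by
      rw [← e2]
      refine integral_congr_ae ?_
      filter_upwards [hw, coeFn_comp c w.1.snd] with x a1 a2
      rw [a2]
      change _ = inner ℝ (fn m₁ x) (inner ℝ c (grad w x))
      rw [a1, real_inner_comm c]
      simp [mul_comm]
    rw [e3, zero_eq_neg] at e1
    rw [← e1]
    refine integral_congr_ae ?_
    filter_upwards [coeFn_comp c m₁.1.snd] with x a1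
    rw [a1, real_inner_comm]
    rfl
  obtain ⟨R, hR⟩ := hΩ.exists_norm_le
  have h5 := poincare hc hR m₁.2
  rw [h4, norm_zero, zero_pow two_ne_zero, mul_zero] at h5
  have h6 : m₁.1.fst = 0 :=
    norm_eq_zero.1 (pow_eq_zero_iff two_ne_zero |>.1 (le_antisymm h5 (sq_nonneg _)))
  have h7 := h₁ m₁
  rw [driftForm_self] at h7
  have h8 : L2.toHm1 (constL2 hΩ 1) m₁ = 0 := by
    change inner ℝ (constL2 hΩ 1) m₁.1.fst = 0
    rw [h6, inner_zero_right]
  rw [h8] at h7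
  have h9 : m₁.1.snd = 0 :=
    norm_eq_zero.1 (pow_eq_zero_iff two_ne_zero |>.1 ((mul_eq_zero.1 h7).resolve_left hν.ne'))
  -- With both components of `m₁` zero, the equation says that the source `1` annihilates all test
  -- functions.
  have h10 : (fun _ : E d => (1 : ℝ)) =ᵐ[volume.restrict Ω] 0 := by
    refine ae_eq_zero_of_forall_isTestFunction hΩo (integrable_const 1) fun φ hφ => ?_
    obtain ⟨w, hw, _⟩ := hφ.exists_H10
    have e := h₁ w
    rw [driftForm_apply, h6, h9, inner_zero_left, inner_zero_left, mul_zero, add_zero,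
      toHm1_apply] at e
    rw [e]
    refine integral_congr_ae ?_
    filter_upwards [hw, coeFn_constL2 hΩ 1] with x a1 a2
    rw [a1, a2]
  have h11 : volume Ω = 0 := by
    have := ae_iff.1 h10
    simpa using this
  exact (hΩo.measure_pos volume hΩn).ne' h11

/-! ### Solutions of the inclusion and of the regularized system -/

theorem isWeakHJB_zero {ν : ℝ} {H : E d → E d → ℝ} (h0 : ∀ x, H x 0 = 0) :
    IsWeakHJB ν H 0 (0 : H10 Ω) := by
  intro ψ
  rw [zero_apply]
  refine integral_eq_zero_of_ae ?_
  filter_upwards [grad_zero_ae (Ω := Ω)] with x hx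
  simp [hx, h0]

theorem isWeakSolutionPDI_zero {ν : ℝ} {c : E d} (hc : ‖c‖ = 1) {G : Hm1 Ω} {m : H10 Ω}
    (hm : IsWeakKFP ν (fun _ => c) G m) :
    IsWeakSolutionPDI ν (unitBallHamiltonian d) 0 G 0 m := by
  refine ⟨fun _ => c, ⟨memLp_top_const c, ?_⟩, ?_, hm⟩
  · filter_upwards [grad_zero_ae (Ω := Ω)] with x hx q
    rw [unitBallHamiltonian_eq_norm, unitBallHamiltonian_eq_norm, hx]
    have := real_inner_le_norm c q
    rw [hc, one_mul] at this
    simpa using this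
  · exact isWeakHJB_zero fun x => by simp [unitBallHamiltonian_eq_norm]

/-- Once `v = 0` is forced, the drift is the gradient at `0`, namely `s`, and the coupled system
reduces to one linear equation. -/
theorem isWeakSolutionPDE_tiltedHuber_iff (hΩ : Bornology.IsBounded Ω) {ν : ℝ} (hν : 0 < ν)
    {l : ℝ} (hl : 0 < l) {s : E d} (hs : ‖s‖ = 1) {v n : H10 Ω} :
    IsWeakSolutionPDE ν (fun _ => tiltedHuber l s) 0 (L2.toHm1 (constL2 hΩ 1)) v n ↔
      v = 0 ∧ IsWeakKFP ν (fun _ => s) (L2.toHm1 (constL2 hΩ 1)) n := by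
  have hgr : ∀ p, ∇ (tiltedHuber l s) p = ballProj l (p + l • s) := fun p =>
    (hasGradientAt_tiltedHuber hl s p).gradient
  have h0 : ballProj l (0 + l • s) = s := by rw [zero_add, ballProj_smul hl hs]
  have hae : (fun x => ballProj l (grad (0 : H10 Ω) x + l • s)) =ᵐ[volume.restrict Ω]
      fun _ => s := by
    filter_upwards [grad_zero_ae (Ω := Ω)] with x hx
    rw [hx, Pi.zero_apply, h0]
  unfold IsWeakSolutionPDE
  simp only [hgr]
  constructor
  · rintro ⟨hv, hn⟩
    obtain rfl : v = 0 := eq_zero_of_isWeakHJB_of_isWeakKFP hΩ hν (continuous_ballProj_add hl s)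
      (fun _ => norm_ballProj_le hl _) (tiltedHuber_subgradient hl s) (tiltedHuber_zero l s)
      (by rw [h0, hs]) hv hn
    exact ⟨rfl, hn.congr_ae hae⟩
  · rintro ⟨rfl, hn⟩
    exact ⟨isWeakHJB_zero fun _ => tiltedHuber_zero l s, hn.congr_ae hae.symm⟩

end MFG
end

/-! ### Alternating selection along a sequence of parameters -/

theorem proposition8p2 (d : ℕ) [NeZero d] (Ω : Set (MFG.E d))
    (hΩ : MFG.IsBoundedLipschitzDomain Ω) (ν : ℝ) (hν : 0 < ν)
    (H : MFG.E d → MFG.E d → ℝ) (hH : H = MFG.unitBallHamiltonian d)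
    (F : MFG.L2 Ω → MFG.Hm1 Ω) (hF : F = 0)
    (G : MFG.Hm1 Ω) (hG : G = MFG.L2.toHm1 (MFG.constL2 hΩ.isBounded 1))
    (e₁ : MFG.E d) (he₁ : e₁ = EuclideanSpace.single 0 1) :
    (∀ x ∈ closure Ω, ∀ p : MFG.E d, H x p = ‖p‖) ∧
    ∃ (Hreg : ℝ → MFG.E d → MFG.E d → ℝ) (lam : ℕ → ℝ) (m₁ m₂ : MFG.H10 Ω),
      MFG.IsRegularizingFamily Ω H 1 Hreg ∧
      (∀ j, lam j ∈ Ioc (0 : ℝ) 1) ∧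
      Tendsto lam atTop (𝓝 0) ∧
      m₁ ≠ m₂ ∧
      MFG.IsWeakSolutionPDI ν H F G 0 m₁ ∧
      MFG.IsWeakSolutionPDI ν H F G 0 m₂ ∧
      MFG.IsWeakKFP ν (fun _ => e₁) G m₁ ∧
      MFG.IsWeakKFP ν (fun _ => -e₁) G m₂ ∧
      ∃ u m : ℕ → MFG.H10 Ω,
        (∀ j, MFG.IsWeakSolutionPDE ν (Hreg (lam j)) F G (u j) (m j) ∧
          ∀ v n : MFG.H10 Ω, MFG.IsWeakSolutionPDE ν (Hreg (lam j)) F G v n →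
            v = u j ∧ n = m j) ∧
        (∀ k, m (2 * k + 1) = m₁ ∧ m (2 * k) = m₂) ∧
        Tendsto (fun k => (u (2 * k + 1), m (2 * k + 1))) atTop (𝓝 (0, m₁)) ∧
        Tendsto (fun k => (u (2 * k), m (2 * k))) atTop (𝓝 (0, m₂)) := by
  subst hH hF hG
  have hc : ‖e₁‖ = 1 := by simp [he₁]
  have hc' : ‖-e₁‖ = 1 := by rwa [norm_neg]
  obtain ⟨m₁, h₁⟩ := MFG.exists_isWeakKFP_const hΩ.isBounded hν hc
    (MFG.L2.toHm1 (MFG.constL2 hΩ.isBounded 1))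
  obtain ⟨m₂, h₂⟩ := MFG.exists_isWeakKFP_const hΩ.isBounded hν hc'
    (MFG.L2.toHm1 (MFG.constL2 hΩ.isBounded 1))
  classical
  -- The tilt is `e₁` exactly at the parameters `1 / (j + 1)` with `j` odd; injectivity of `j ↦ 1 /
  -- (j + 1)` and parity give `-e₁` for even `j`.
  let s : ℝ → MFG.E d := fun l => if ∃ k : ℕ, l = 1 / ((2 * k + 1 : ℕ) + 1) then e₁ else -e₁
  have hs : ∀ l, ‖s l‖ = 1 := fun l => by
    simp only [s]
    split_ifs <;> assumption
  let lam : ℕ → ℝ := fun j => 1 / ((j : ℝ) + 1)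
  have hlam : ∀ j, lam j ∈ Ioc (0 : ℝ) 1 := fun j =>
    ⟨Nat.one_div_pos_of_nat, (div_le_one (by positivity)).2 (by simp)⟩
  have hodd : ∀ k, s (lam (2 * k + 1)) = e₁ := fun k => if_pos ⟨k, rfl⟩
  have heven : ∀ k, s (lam (2 * k)) = -e₁ := fun k => if_neg (by
    rintro ⟨i, hi⟩
    simp only [lam] at hi
    rw [one_div, one_div, inv_inj, add_left_inj, Nat.cast_inj] at hi
    omega)
  let m : ℕ → MFG.H10 Ω := fun j => if Odd j then m₁ else m₂
  have hmodd : ∀ k, m (2 * k + 1) = m₁ := fun k => if_pos (odd_two_mul_add_one k)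
  have hmeven : ∀ k, m (2 * k) = m₂ := fun k => if_neg (by simp)
  have hm : ∀ j, MFG.IsWeakKFP ν (fun _ => s (lam j))
      (MFG.L2.toHm1 (MFG.constL2 hΩ.isBounded 1)) (m j) := by
    intro j
    obtain ⟨k, rfl | rfl⟩ := Nat.even_or_odd' j
    · rwa [heven, hmeven]
    · rwa [hodd, hmodd]
  refine ⟨fun x _ p => MFG.unitBallHamiltonian_eq_norm x p,
    fun l _ => MFG.tiltedHuber l (s l), lam, m₁, m₂, MFG.isRegularizingFamily_tiltedHuber Ω hs,
    hlam, tendsto_one_div_add_atTop_nhds_zero_nat,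
    h₁.ne_of_neg_drift hΩ.isBounded hΩ.isOpen hΩ.isConnected.nonempty hc h₂ hν,
    MFG.isWeakSolutionPDI_zero hc h₁, MFG.isWeakSolutionPDI_zero hc' h₂, h₁, h₂,
    0, m, fun j => ⟨?_, fun v n h => ?_⟩, fun k => ⟨hmodd k, hmeven k⟩, ?_, ?_⟩
  · exact (MFG.isWeakSolutionPDE_tiltedHuber_iff hΩ.isBounded hν (hlam j).1 (hs _)).2 ⟨rfl, hm j⟩
  · obtain ⟨hv, hn⟩ :=
      (MFG.isWeakSolutionPDE_tiltedHuber_iff hΩ.isBounded hν (hlam j).1 (hs _)).1 h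
    exact ⟨hv, hn.unique_const hΩ.isBounded hν (hs _) (hm j)⟩
  · simp only [hmodd]
    exact tendsto_const_nhds
  · simp only [hmeven]
    exact tendsto_const_nhds
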